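/- Let $G=(V,E)$ be a finite connected simple graph with a positive weight $w_e>0$ on every edge $e\in E$, regarded as a resistor network in which edge $e$ has resistance $R_e=1/w_e$. Fix an arbitrary orientation of the edges, let $\mathbf B\in\mathbb R^{V\times E}$ be the resulting incidence matrix ($B_{n,e}=1$ if $e$ starts at $n$, $-1$ if $e$ ends at $n$, $0$ otherwise) and $\mathbf R=\operatorname{diag}(R_e)_{e\in E}$. Let $s,t\in V$, and inject a unit current at $s$ and withdraw it at $t$, i.e. let $\mathbf I=\mathbf e_s-\mathbf e_t$. Then there is exactly one vector of currents $\mathbf i\in\mathbb R^{E}$ satisfying Kirchhoff's current law $\mathbf B\mathbf i=\mathbf I$ and, for some vector of nodal voltages $\mathbf U\in\mathbb R^V$, Ohm's law $\mathbf R\mathbf i=\mathbf B^\top\mathbf U$. For every edge $\{a,b\}\in E$, the current $i_{ab}$ flowing from $a$ to $b$ (the entry of $\mathbf i$ at this edge if the edge is oriented from $a$ to $b$, and minus this entry otherwise) is $$ i_{ab}=\frac{\mathcal N^*(s,a\to b,t)-\mathcal N^*(s,b\to a,t)}{\mathcal N^*}. $$ Here $\mathcal N^*=\sum_{T\in\mathcal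 T}\prod_{e\in T}w_e$, where $\mathcal T$ is the set of all spanning trees of $G$, and $\mathcal N^*(s,a\to b,t)$ is the same sum restricted to those spanning trees whose path from $s$ to $t$ has the form $s,\dots,a,b,\dots,t$, i.e. traverses $a$ and immediately afterwards $b$. Moreover $\mathcal N^*>0$, so the quotient is well defined. -/

import Mathlib

open scoped Matrix

noncomputable section

namespace ResistorNetwork

variable {V : Type*}

/-- An orientation of a graph: every edge is assigned one of its two directions, i.e. a starting
vertex `(dir e).fst` and an end vertex `(dir e).snd`. -/
structure Orientation (G : SimpleGraph V) where
  dir : G.edgeSet → G.Dart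
  edge_dir : ∀ e, (dir e).edge = (e : Sym2 V)

open Classical in
/-- The node-edge incidence matrix `B` of an oriented graph: `B n e` is `1` if `e` starts at `n`,
`-1` if `e` ends at `n`, and `0` otherwise. -/
def incidence {G : SimpleGraph V} (o : Orientation G) : Matrix V G.edgeSet ℝ :=
  Matrix.of fun n e => if n = (o.dir e).fst then 1 else if n = (o.dir e).snd then -1 else 0

open Classical in
/-- The diagonal matrix `R` of edge resistances; the resistance of an edge is the inverse of its
weight. -/
def resistance (G : SimpleGraph V) (w : Sym2 V → ℝ) : Matrix G.edgeSet G.edgeSet ℝ :=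
  Matrix.diagonal fun e => (w e)⁻¹

open Classical in
/-- The injection pattern `e_s - e_t`: a unit current is injected at `s` and withdrawn at `t`. -/
def unitInjection (s t : V) : V → ℝ :=
  Pi.single s 1 - Pi.single t 1

open Classical in
/-- `i` is a vector of current flows for the injection pattern `I`: Kirchhoff's current law
`B i = I` holds and there are nodal voltages `U` for which Ohm's law `R i = Bᵀ U` holds. -/
def IsCurrent [Fintype V] {G : SimpleGraph V} (o : Orientation G) (w : Sym2 V → ℝ) (I : V → ℝ)
    (i : G.edgeSet → ℝ) : Prop :=
  incidence o *ᵥ i = I ∧ ∃ U : V → ℝ, resistance G w *ᵥ i = (incidence o)ᵀ *ᵥ U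

open Classical in
/-- The current `i_{ab}` flowing from `a` to `b` along the edge `{a, b}`: the entry of `i` at this
edge, with a minus sign if the orientation directs the edge from `b` to `a`. -/
def currentAlong {G : SimpleGraph V} (o : Orientation G) (i : G.edgeSet → ℝ) {a b : V}
    (h : G.Adj a b) : ℝ :=
  if (o.dir ⟨s(a, b), h⟩).fst = a then i ⟨s(a, b), h⟩ else -i ⟨s(a, b), h⟩

open Classical in
/-- The finite set of spanning trees of `G`: a spanning tree is a tree on the whole vertex set all
of whose edges are edges of `G`. -/
def spanningTrees [Fintype V] (G : SimpleGraph V) : Finset (SimpleGraph V) :=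
  Finset.univ.filter fun T => T ≤ G ∧ T.IsTree

open Classical in
/-- The weight of a graph `T`: the product of the weights of its edges. -/
def weight [Fintype V] (w : Sym2 V → ℝ) (T : SimpleGraph V) : ℝ :=
  ∏ e ∈ T.edgeFinset, w e

/-- `T` contains a path from `s` to `t` of the form `s, …, a, b, …, t`, i.e. one that traverses
`a` and, immediately after it, `b`. -/
def PathTraverses (T : SimpleGraph V) (s a b t : V) : Prop :=
  ∃ p : T.Walk s t, p.IsPath ∧ ∃ d ∈ p.darts, d.fst = a ∧ d.snd = b

/-- `N*`: the sum of the weights of all spanning trees. -/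
def treeSum [Fintype V] (G : SimpleGraph V) (w : Sym2 V → ℝ) : ℝ :=
  ∑ T ∈ spanningTrees G, weight w T

open Classical in
/-- `N*(s, a → b, t)`: the sum of the weights of all spanning trees that contain a path of the
form `s, …, a, b, …, t`. -/
def treeSumThrough [Fintype V] (G : SimpleGraph V) (w : Sym2 V → ℝ) (s a b t : V) : ℝ :=
  ∑ T ∈ (spanningTrees G).filter (fun T => PathTraverses T s a b t), weight w T

end ResistorNetwork

end

open SimpleGraph

/-! The quotient of tree sums is shown to satisfy both laws, and uniqueness does the rest. Current
law: in each spanning tree the `s`-`t` path carries a unit flow, and the formula is the weighted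
average of these flows (`sum_mul_count_darts`). Ohm's law: deleting `ab` from a tree whose path runs
`a → b` leaves a two-component forest separating `s` from `t`, with `a` on the side of `s` and `b`
on that of `t`; this is a bijection that divides weights by `w s(a, b)`. Hence the numerator is `w
s(a, b)` times a difference of forest sums, which serve as voltages (`treeSumThrough_sub`).
Uniqueness is an energy argument. -/

namespace ResistorNetwork

variable {V : Type*}

/-! ### Exchange between trees and two-component forests -/

/-- If a trail from `s` to `t` traverses `a` and then `b`, then removing the edge `ab` leaves `s`
connected to `a` and `b` connected to `t`. -/
lemma reachable_deleteEdges_of_mem_darts {T : SimpleGraph V} {s t : V} (p : T.Walk s t)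
    (hp : p.IsTrail) (d : T.Dart) (hd : d ∈ p.darts) :
    (T.deleteEdges {s(d.fst, d.snd)}).Reachable s d.fst ∧
      (T.deleteEdges {s(d.fst, d.snd)}).Reachable d.snd t := by
  induction p with
  | nil => simp at hd
  | @cons u v x h p ih =>
    rw [Walk.isTrail_cons] at hp
    rw [Walk.darts_cons, List.mem_cons] at hd
    rcases hd with rfl | hd
    · exact ⟨Reachable.refl _, ⟨p.toDeleteEdge _ hp.2⟩⟩
    · obtain ⟨h1, h2⟩ := ih hp.1 hd
      have he : s(d.fst, d.snd) ∈ p.edges := List.mem_map.2 ⟨d, hd, rfl⟩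
      have hne : s(u, v) ≠ s(d.fst, d.snd) := fun hh => hp.2 (hh ▸ he)
      have hadj : (T.deleteEdges {s(d.fst, d.snd)}).Adj u v := by
        rw [deleteEdges_adj]
        exact ⟨h, hne⟩
      exact ⟨hadj.reachable.trans h1, h2⟩

/-- The part of the walk before its first use of `ab` survives the deletion, and it ends at `a` or
`b`. -/
lemma reachable_deleteEdges_left_or_right {T : SimpleGraph V} {x a : V} (b : V)
    (p : T.Walk x a) :
    (T.deleteEdges {s(a, b)}).Reachable x a ∨ (T.deleteEdges {s(a, b)}).Reachable x b := by
  induction p with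
  | nil => exact Or.inl (Reachable.refl _)
  | @cons u v a h p ih =>
    by_cases he : s(u, v) = s(a, b)
    · rcases Sym2.eq_iff.1 he with ⟨rfl, -⟩ | ⟨rfl, -⟩
      · exact Or.inl (Reachable.refl _)
      · exact Or.inr (Reachable.refl _)
    · have hadj : (T.deleteEdges {s(a, b)}).Adj u v := by
        rw [deleteEdges_adj]
        exact ⟨h, he⟩
      exact ih.imp hadj.reachable.trans hadj.reachable.trans

lemma deleteEdges_sup_edge {T : SimpleGraph V} {a b : V} (h : T.Adj a b) :
    T.deleteEdges {s(a, b)} ⊔ edge a b = T := by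
  ext x y
  simp only [deleteEdges_adj, sup_adj, adj_edge, Set.mem_singleton_iff]
  constructor
  · rintro (h' | ⟨h', -⟩)
    · exact h'.1
    · rwa [← mem_edgeSet, ← h', mem_edgeSet]
  · intro h'
    by_cases he : s(x, y) = s(a, b)
    · exact Or.inr ⟨he.symm, h'.ne⟩
    · exact Or.inl ⟨h', he⟩

lemma sup_edge_deleteEdges {F : SimpleGraph V} {a b : V} (h : ¬ F.Adj a b) :
    (F ⊔ edge a b).deleteEdges {s(a, b)} = F := by
  ext x y
  simp only [deleteEdges_adj, sup_adj, adj_edge, Set.mem_singleton_iff]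
  constructor
  · rintro ⟨h | h, h'⟩
    · exact h
    · exact absurd h.1.symm h'
  · refine fun h1 => ⟨Or.inl h1, fun h' => h ?_⟩
    rwa [← mem_edgeSet, ← h', mem_edgeSet]

/-- `F` is a spanning forest with two components, one containing `s` and the other `t`. -/
structure IsSeparatingForest (F : SimpleGraph V) (s t : V) : Prop where
  isAcyclic : F.IsAcyclic
  not_reachable : ¬ F.Reachable s t
  reachable_or : ∀ x, F.Reachable s x ∨ F.Reachable x t

lemma PathTraverses.isSeparatingForest {T : SimpleGraph V} (hT : T.IsTree) {s a b t : V}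
    (h : PathTraverses T s a b t) :
    T.Adj a b ∧ IsSeparatingForest (T.deleteEdges {s(a, b)}) s t ∧
      (T.deleteEdges {s(a, b)}).Reachable s a ∧ ¬ (T.deleteEdges {s(a, b)}).Reachable s b := by
  obtain ⟨p, hp, d, hd, rfl, rfl⟩ := h
  obtain ⟨h1, h2⟩ := reachable_deleteEdges_of_mem_darts p hp.isTrail d hd
  have hb : ¬ (T.deleteEdges {s(d.fst, d.snd)}).Reachable d.fst d.snd :=
    isBridge_iff.1 (isAcyclic_iff_forall_adj_isBridge.1 hT.isAcyclic d.adj)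
  refine ⟨d.adj, ⟨hT.isAcyclic.anti (deleteEdges_le _), fun hst => hb ?_, fun x => ?_⟩, h1,
    fun hsb => hb (h1.symm.trans hsb)⟩
  · exact h1.symm.trans (hst.trans h2.symm)
  · obtain ⟨q⟩ := hT.connected.preconnected x d.fst
    exact (reachable_deleteEdges_left_or_right d.snd q).imp (fun h => h1.trans h.symm)
      (fun h => h.trans h2)

/-- The new edge joins the two components, so every `s`-`t` path must use it. -/
lemma IsSeparatingForest.sup_edge {F : SimpleGraph V} {s t a b : V}
    (hF : IsSeparatingForest F s t) (ha : F.Reachable s a) (hb : ¬ F.Reachable s b) :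
    ¬ F.Adj a b ∧ (F ⊔ edge a b).IsTree ∧ PathTraverses (F ⊔ edge a b) s a b t := by
  have hab : ¬ F.Reachable a b := fun h => hb (ha.trans h)
  have hne : a ≠ b := fun h => hab (h ▸ Reachable.refl _)
  have hnadj : ¬ F.Adj a b := fun h => hab h.reachable
  have hbt : F.Reachable b t := (hF.reachable_or b).resolve_left hb
  have hle : F ≤ F ⊔ edge a b := le_sup_left
  have hadj : (F ⊔ edge a b).Adj a b := Or.inr ((edge_adj ..).2 ⟨Or.inl ⟨rfl, rfl⟩, hne⟩)
  have hdel : (F ⊔ edge a b).deleteEdges {s(a, b)} = F := sup_edge_deleteEdges hnadj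
  have hst : (F ⊔ edge a b).Reachable s t :=
    (ha.mono hle).trans (hadj.reachable.trans (hbt.mono hle))
  have hconn : ∀ x, (F ⊔ edge a b).Reachable s x := fun x =>
    (hF.reachable_or x).elim (fun h => h.mono hle) (fun h => hst.trans (h.mono hle).symm)
  have hacyc : (F ⊔ edge a b).IsAcyclic :=
    (isAcyclic_add_edge_iff_of_not_reachable a b hab).2 hF.isAcyclic
  have : Nonempty V := ⟨s⟩
  refine ⟨hnadj, ⟨⟨fun x y => (hconn x).symm.trans (hconn y)⟩, hacyc⟩, ?_⟩
  obtain ⟨p, hp⟩ := hst.exists_isPath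
  have hmem : s(a, b) ∈ p.edges := by
    by_contra h
    exact hF.not_reachable (hdel ▸ ⟨p.toDeleteEdge _ h⟩)
  obtain ⟨d, hd, hde⟩ := List.mem_map.1 hmem
  refine ⟨p, hp, d, hd, ?_⟩
  have hde' : s(d.fst, d.snd) = s(a, b) := hde
  rcases Sym2.eq_iff.1 hde' with h | ⟨h1, h2⟩
  · exact h
  -- Crossing from `b` to `a` would put `b` on the side of `s` in `F`.
  · have := (reachable_deleteEdges_of_mem_darts p hp.isTrail d hd).1
    rw [hde', hdel, h1] at this
    exact absurd this hb

/-! ### Unit flows along walks and tree paths -/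

lemma incidence_apply {G : SimpleGraph V} (o : Orientation G) [DecidableEq V] (n : V)
    (e : G.edgeSet) : incidence o n e =
      (Pi.single n 1 : V → ℝ) (o.dir e).fst - (Pi.single n 1 : V → ℝ) (o.dir e).snd := by
  have := (o.dir e).adj.ne
  simp only [incidence, Matrix.of_apply, Pi.single_apply]
  grind

/-- The signed number of times a walk traverses an edge is a unit flow from its start to its end. -/
lemma sum_mul_count_darts {G H : SimpleGraph V} [Fintype G.edgeSet] [DecidableEq V] (hH : H ≤ G)
    (o : Orientation G) (f : V → ℝ) {s t : V} (p : H.Walk s t) :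
    ∑ e, (f (o.dir e).fst - f (o.dir e).snd) *
      (((p.darts.map Dart.toProd).count ((o.dir e).fst, (o.dir e).snd) : ℝ) -
        ((p.darts.map Dart.toProd).count ((o.dir e).snd, (o.dir e).fst) : ℝ)) = f s - f t := by
  induction p with
  | nil => simp
  | @cons u v x h p ih =>
    -- One step of the walk contributes `f u - f v`; the induction telescopes these.
    have key : ∑ e, (f (o.dir e).fst - f (o.dir e).snd) *
        ((if (u, v) = ((o.dir e).fst, (o.dir e).snd) then (1 : ℝ) else 0) -
          (if (u, v) = ((o.dir e).snd, (o.dir e).fst) then 1 else 0)) = f u - f v := by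
      have hedge : ∀ e : G.edgeSet, s((o.dir e).fst, (o.dir e).snd) = (e : Sym2 V) := o.edge_dir
      rw [Finset.sum_eq_single (⟨s(u, v), hH h⟩ : G.edgeSet)]
      · have := h.ne
        rcases Sym2.eq_iff.1 (hedge ⟨s(u, v), hH h⟩) with ⟨h1, h2⟩ | ⟨h1, h2⟩ <;>
          simp [h1, h2, this, this.symm]
      · intro e _ he
        have h1 : (u, v) ≠ ((o.dir e).fst, (o.dir e).snd) := fun hh => he <| Subtype.ext <| by
          rw [← hedge e]
          exact (congrArg (fun q : V × V => s(q.1, q.2)) hh).symm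
        have h2 : (u, v) ≠ ((o.dir e).snd, (o.dir e).fst) := fun hh => he <| Subtype.ext <| by
          rw [← hedge e, Sym2.eq_swap]
          exact (congrArg (fun q : V × V => s(q.1, q.2)) hh).symm
        simp [h1, h2]
      · simp
    rw [← sub_add_sub_cancel (f u) (f v), ← key, ← ih, ← Finset.sum_add_distrib]
    refine Finset.sum_congr rfl fun e _ => ?_
    simp only [Walk.darts_cons, List.map_cons, List.count_cons, beq_iff_eq, Nat.cast_add,
      Nat.cast_ite, Nat.cast_one, Nat.cast_zero]
    ring

/-- Paths in a tree are unique, and a path repeats no dart, so the count is 0 or 1. -/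
lemma ite_pathTraverses_eq_count {T : SimpleGraph V} [DecidableEq V] (hT : T.IsTree) {s t : V}
    (p : T.Walk s t) (hp : p.IsPath) (a b : V) [Decidable (PathTraverses T s a b t)] :
    (if PathTraverses T s a b t then (1 : ℝ) else 0) = (p.darts.map Dart.toProd).count (a, b) := by
  have hnd : (p.darts.map Dart.toProd).Nodup :=
    (hp.isTrail.edges_nodup.of_map _).map Dart.toProd_injective
  have hiff : PathTraverses T s a b t ↔ (a, b) ∈ p.darts.map Dart.toProd := by
    rw [List.mem_map]
    constructor
    · rintro ⟨q, hq, d, hd, rfl, rfl⟩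
      have : q = p := congrArg Subtype.val
        ((hT.isAcyclic.subsingleton_path s t).elim ⟨q, hq⟩ ⟨p, hp⟩)
      exact ⟨d, this ▸ hd, rfl⟩
    · rintro ⟨d, hd, h⟩
      exact ⟨p, hp, d, hd, congrArg Prod.fst h, congrArg Prod.snd h⟩
  rw [List.Nodup.count hnd]
  simp [hiff]

lemma resistance_mulVec (G : SimpleGraph V) [Fintype G.edgeSet] (w : Sym2 V → ℝ) (i : G.edgeSet → ℝ)
    (e : G.edgeSet) : (resistance G w *ᵥ i) e = (w e)⁻¹ * i e := by
  classical
  unfold resistance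
  convert Matrix.mulVec_diagonal _ _ _

/-! ### Forest sums as voltages -/

section Finite

variable [Fintype V]

lemma weight_sup_edge (w : Sym2 V → ℝ) {F : SimpleGraph V} {a b : V} (hne : a ≠ b)
    (h : ¬ F.Adj a b) : weight w (F ⊔ edge a b) = w s(a, b) * weight w F := by
  classical
  unfold weight
  rw [← Finset.prod_cons (s := F.edgeFinset) (a := s(a, b)) (h := by simpa using h)]
  refine Finset.prod_congr ?_ fun _ _ => rfl
  convert edgeFinset_sup_edge F h hne

open Classical in
/-- The spanning forests of `G` with two components, one containing `s` and the other `t`. -/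
noncomputable def separatingForests (G : SimpleGraph V) (s t : V) : Finset (SimpleGraph V) :=
  Finset.univ.filter fun F => F ≤ G ∧ IsSeparatingForest F s t

open Classical in
/-- The sum of the weights of the spanning forests with two components, one containing `s` and `x`,
the other containing `t`. This is, up to normalization, the voltage at `x`. -/
noncomputable def forestPotential (G : SimpleGraph V) (w : Sym2 V → ℝ) (s t x : V) : ℝ :=
  ∑ F ∈ (separatingForests G s t).filter fun F => F.Reachable s x, weight w F

open Classical in
lemma treeSumThrough_eq_mul_sum_forests (G : SimpleGraph V) (w : Sym2 V → ℝ) (s t : V) {a b : V}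
    (h : G.Adj a b) :
    treeSumThrough G w s a b t = w s(a, b) *
      ∑ F ∈ (separatingForests G s t).filter fun F => F.Reachable s a ∧ ¬ F.Reachable s b,
        weight w F := by
  rw [treeSumThrough, Finset.mul_sum]
  refine Finset.sum_bij' (fun T _ => T.deleteEdges {s(a, b)}) (fun F _ => F ⊔ edge a b)
    ?_ ?_ ?_ ?_ ?_
  · intro T hT
    simp only [spanningTrees, separatingForests, Finset.mem_filter, Finset.mem_univ,
      true_and] at hT ⊢
    obtain ⟨-, h1, h2⟩ := hT.2.isSeparatingForest hT.1.2
    exact ⟨⟨(deleteEdges_le _).trans hT.1.1, h1⟩, h2⟩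
  · intro F hF
    simp only [spanningTrees, separatingForests, Finset.mem_filter, Finset.mem_univ,
      true_and] at hF ⊢
    obtain ⟨-, h1, h2⟩ := hF.1.2.sup_edge hF.2.1 hF.2.2
    exact ⟨⟨sup_le hF.1.1 ((edge_le_iff G).2 (Or.inr h)), h1⟩, h2⟩
  · intro T hT
    simp only [spanningTrees, Finset.mem_filter, Finset.mem_univ, true_and] at hT
    exact deleteEdges_sup_edge (hT.2.isSeparatingForest hT.1.2).1
  · intro F hF
    simp only [separatingForests, Finset.mem_filter, Finset.mem_univ, true_and] at hF
    exact sup_edge_deleteEdges (hF.1.2.sup_edge hF.2.1 hF.2.2).1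
  · intro T hT
    simp only [spanningTrees, Finset.mem_filter, Finset.mem_univ, true_and] at hT
    have hadj := (hT.2.isSeparatingForest hT.1.2).1
    rw [← weight_sup_edge w h.ne (by simp), deleteEdges_sup_edge hadj]

/-- Ohm's law before normalization: forests with both `a` and `b` on the side of `s` cancel in the
difference of potentials. -/
lemma treeSumThrough_sub (G : SimpleGraph V) (w : Sym2 V → ℝ) (s t : V) {a b : V}
    (h : G.Adj a b) :
    treeSumThrough G w s a b t - treeSumThrough G w s b a t =
      w s(a, b) * (forestPotential G w s t a - forestPotential G w s t b) := by
  classical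
  rw [treeSumThrough_eq_mul_sum_forests G w s t h, treeSumThrough_eq_mul_sum_forests G w s t h.symm,
    Sym2.eq_swap (a := b), ← mul_sub, forestPotential, forestPotential]
  simp only [Finset.sum_filter, ← Finset.sum_sub_distrib]
  congr 1
  refine Finset.sum_congr rfl fun F _ => ?_
  by_cases ha : F.Reachable s a <;> by_cases hb : F.Reachable s b <;> simp [ha, hb]

lemma weight_pos {G T : SimpleGraph V} {w : Sym2 V → ℝ} (hw : ∀ e ∈ G.edgeSet, 0 < w e)
    (hT : T ≤ G) : 0 < weight w T := by
  classical
  exact Finset.prod_pos fun e he => hw e (edgeSet_mono hT (mem_edgeFinset.1 he))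

lemma treeSum_pos {G : SimpleGraph V} (hG : G.Connected) {w : Sym2 V → ℝ}
    (hw : ∀ e ∈ G.edgeSet, 0 < w e) : 0 < treeSum G w := by
  classical
  obtain ⟨T, hT, hT'⟩ := hG.exists_isTree_le
  refine Finset.sum_pos (fun T hT => weight_pos hw ?_) ⟨T, ?_⟩
  · exact (Finset.mem_filter.1 hT).2.1
  · simp [spanningTrees, hT, hT']

lemma transpose_incidence_mulVec {G : SimpleGraph V} (o : Orientation G) (U : V → ℝ)
    (e : G.edgeSet) :
    ((incidence o)ᵀ *ᵥ U) e = U (o.dir e).fst - U (o.dir e).snd := by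
  classical
  simp [Matrix.mulVec, dotProduct, incidence_apply, sub_mul, Finset.sum_sub_distrib,
    Pi.single_apply]

/-! ### The tree current: both laws and uniqueness -/

/-- The currents given by the spanning tree formula, in the orientation of the edges. -/
noncomputable def treeCurrent {G : SimpleGraph V} (o : Orientation G) (w : Sym2 V → ℝ) (s t : V) :
    G.edgeSet → ℝ := fun e =>
  (treeSumThrough G w s (o.dir e).fst (o.dir e).snd t -
    treeSumThrough G w s (o.dir e).snd (o.dir e).fst t) / treeSum G w

lemma incidence_mulVec_treeCurrent {G : SimpleGraph V} [Fintype G.edgeSet] (o : Orientation G)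
    {w : Sym2 V → ℝ} (hN : treeSum G w ≠ 0) (s t : V) :
    incidence o *ᵥ treeCurrent o w s t = unitInjection s t := by
  classical
  funext n
  -- Each tree alone meets the current law; averaging over trees then only swaps sums.
  have htree : ∀ T ∈ spanningTrees G, ∑ e, incidence o n e *
      ((if PathTraverses T s (o.dir e).fst (o.dir e).snd t then (1 : ℝ) else 0) -
        (if PathTraverses T s (o.dir e).snd (o.dir e).fst t then (1 : ℝ) else 0)) =
      unitInjection s t n := by
    intro T hT
    obtain ⟨hle, hT⟩ := (Finset.mem_filter.1 hT).2
    obtain ⟨p, hp⟩ := (hT.connected.preconnected s t).exists_isPath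
    have := sum_mul_count_darts hle o (Pi.single n 1 : V → ℝ) p
    simp only [ite_pathTraverses_eq_count hT p hp, incidence_apply]
    rw [this]
    simp only [unitInjection, Pi.sub_apply, Pi.single_apply, eq_comm]
  have hcur : ∀ e, treeCurrent o w s t e = (∑ T ∈ spanningTrees G, weight w T *
      ((if PathTraverses T s (o.dir e).fst (o.dir e).snd t then (1 : ℝ) else 0) -
        (if PathTraverses T s (o.dir e).snd (o.dir e).fst t then (1 : ℝ) else 0))) /
          treeSum G w := by
    intro e
    simp [treeCurrent, treeSumThrough, Finset.sum_filter, mul_sub, Finset.sum_sub_distrib]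
  simp only [Matrix.mulVec, dotProduct, hcur, ← mul_div_assoc, ← Finset.sum_div]
  rw [div_eq_iff hN]
  simp only [Finset.mul_sum]
  rw [Finset.sum_comm, treeSum, Finset.mul_sum]
  refine Finset.sum_congr rfl fun T hT => ?_
  rw [← htree T hT, Finset.sum_mul]
  exact Finset.sum_congr rfl fun e _ => by ring

lemma isCurrent_treeCurrent {G : SimpleGraph V} (hG : G.Connected) (o : Orientation G)
    {w : Sym2 V → ℝ} (hw : ∀ e ∈ G.edgeSet, 0 < w e) (s t : V) :
    IsCurrent o w (unitInjection s t) (treeCurrent o w s t) := by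
  classical
  refine ⟨incidence_mulVec_treeCurrent o (treeSum_pos hG hw).ne' s t,
    fun x => forestPotential G w s t x / treeSum G w, ?_⟩
  funext e
  have he : s((o.dir e).fst, (o.dir e).snd) = (e : Sym2 V) := o.edge_dir e
  have hwe : w e ≠ 0 := (hw e e.2).ne'
  rw [resistance_mulVec, transpose_incidence_mulVec, treeCurrent,
    treeSumThrough_sub G w s t (o.dir e).adj, he, ← sub_div]
  field_simp

/-- Currents are determined by the injection pattern, since a circulation of zero energy
vanishes. -/
lemma IsCurrent.unique {G : SimpleGraph V} {o : Orientation G} {w : Sym2 V → ℝ}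
    (hw : ∀ e ∈ G.edgeSet, 0 < w e) {I : V → ℝ} {i j : G.edgeSet → ℝ}
    (hi : IsCurrent o w I i) (hj : IsCurrent o w I j) : i = j := by
  classical
  obtain ⟨hi, U, hU⟩ := hi
  obtain ⟨hj, W, hW⟩ := hj
  have h1 : incidence o *ᵥ (i - j) = 0 := by
    rw [Matrix.mulVec_sub, hi, hj, sub_self]
  have h2 : resistance G w *ᵥ (i - j) = (incidence o)ᵀ *ᵥ (U - W) := by
    rw [Matrix.mulVec_sub, Matrix.mulVec_sub, hU, hW]
  -- Moving `B` across the pairing turns the energy into the pairing of `B (i - j) = 0` with `U -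
  -- W`.
  have h3 : (i - j) ⬝ᵥ (resistance G w *ᵥ (i - j)) = 0 := by
    rw [h2, Matrix.dotProduct_mulVec, Matrix.vecMul_transpose, h1, zero_dotProduct]
  simp only [dotProduct, resistance_mulVec] at h3
  have hnn : ∀ e ∈ Finset.univ, 0 ≤ (i - j) e * ((w e)⁻¹ * (i - j) e) := fun e _ => by
    have := inv_pos.2 (hw e e.2)
    nlinarith [mul_nonneg this.le (mul_self_nonneg ((i - j) e))]
  rw [Finset.sum_eq_zero_iff_of_nonneg hnn] at h3
  funext e
  have := h3 e (Finset.mem_univ e)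
  have hwe : w e ≠ 0 := (hw e e.2).ne'
  simpa [hwe, sub_eq_zero] using this

lemma currentAlong_treeCurrent {G : SimpleGraph V} (o : Orientation G) (w : Sym2 V → ℝ) (s t : V)
    {a b : V} (h : G.Adj a b) :
    currentAlong o (treeCurrent o w s t) h =
      (treeSumThrough G w s a b t - treeSumThrough G w s b a t) / treeSum G w := by
  have he : s((o.dir ⟨s(a, b), h⟩).fst, (o.dir ⟨s(a, b), h⟩).snd) = s(a, b) :=
    o.edge_dir ⟨s(a, b), h⟩
  rcases Sym2.eq_iff.1 he with ⟨h1, h2⟩ | ⟨h1, h2⟩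
  · rw [currentAlong, if_pos h1, treeCurrent, h1, h2]
  · rw [currentAlong, if_neg (h1.trans_ne h.ne'), treeCurrent, h1, h2, ← neg_div, neg_sub]

end Finite

end ResistorNetwork

theorem mainTheorem1 {V : Type*} [Fintype V] (G : SimpleGraph V) (hG : G.Connected)
    (w : Sym2 V → ℝ) (hw : ∀ e ∈ G.edgeSet, 0 < w e) (o : ResistorNetwork.Orientation G)
    (s t : V) :
    0 < ResistorNetwork.treeSum G w ∧
    (∃! i : G.edgeSet → ℝ,
      ResistorNetwork.IsCurrent o w (ResistorNetwork.unitInjection s t) i) ∧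
    ∀ i : G.edgeSet → ℝ,
      ResistorNetwork.IsCurrent o w (ResistorNetwork.unitInjection s t) i →
      ∀ (a b : V) (h : G.Adj a b),
        ResistorNetwork.currentAlong o i h =
          (ResistorNetwork.treeSumThrough G w s a b t -
            ResistorNetwork.treeSumThrough G w s b a t) / ResistorNetwork.treeSum G w := by

  have hcur := ResistorNetwork.isCurrent_treeCurrent hG o hw s t
  refine ⟨ResistorNetwork.treeSum_pos hG hw, ⟨_, hcur, fun j hj => hj.unique hw hcur⟩,
    fun i hi a b h => ?_⟩
  rw [hi.unique hw hcur]
  exact ResistorNetwork.currentAlong_treeCurrent o w s t h
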